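/- Let $l,p$ be positive integers with $p>2$ and $2l<p$, and let $$C(l,p)=\Big\{\sum_{i=1}^{\infty}\frac{x_i}{p^i} : x_i\in\{0,\dots,l-1\}\cup\{p-l,\dots,p-1\}\text{ for all } i\ge 1\Big\}\subset[0,1]$$ be the symmetric S-Cantor set. Write $D=C(l,p)-C(l,p)=\{x-y : x,y\in C(l,p)\}$. Then: 1. $D=[-1,1]$ if and only if $\frac{l}{p}\ge\frac13$; 2. $D$ is a Cantor set if and only if $\frac{l}{p}\le\frac14$; 3. $D$ is an M-Cantorval if and only if $\frac{l}{p}\in\left(\frac14,\frac13\right)$. Here a Cantor set is a nonempty, bounded, perfect and nowhere dense subset of $\mathbb R$. A gap of $E\subset\mathbb R$ is a bounded connected component of $\mathbb R\setminus E$, and a proper component of $E$ is a connected component of $E$ that is not a singleton. An M-Cantorval is a perfect set $E\subset\mathbb R$ that has infinitely many gaps and is such that both endpoints of every gap are accumulated by gaps and by proper components of $E$, i.e. every neighbourhood of such an endpoint contains a gap of $E$ and a proper component of $E$. -/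

import Mathlib

open scoped Pointwise

/-- For a set `A` of integer digits, the set `A_p` of all real numbers of the form
`∑_{i ≥ 1} x_i / p ^ i` with all `x_i ∈ A` (here the sequence is indexed from `0`). -/
def digitSet (p : ℕ) (A : Set ℤ) : Set ℝ :=
  {x | ∃ d : ℕ → ℤ, (∀ i, d i ∈ A) ∧ HasSum (fun i : ℕ => (d i : ℝ) / (p : ℝ) ^ (i + 1)) x}

/-- The digit set `A(l, r, p) = {0, …, l - 1} ∪ {p - r, …, p - 1}`. -/
def sDigits (l r p : ℕ) : Set ℤ :=
  Set.Icc (0 : ℤ) ((l : ℤ) - 1) ∪ Set.Icc ((p : ℤ) - (r : ℤ)) ((p : ℤ) - 1)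

/-- The S-Cantor set `C(l, r, p)`. -/
def sCantorSet (l r p : ℕ) : Set ℝ :=
  digitSet p (sDigits l r p)

/-- The symmetric S-Cantor set `C(l, p) = C(l, l, p)`. -/
def symmSCantorSet (l p : ℕ) : Set ℝ :=
  sCantorSet l l p

/-- A Cantor set: a (nonempty) bounded, perfect and nowhere dense subset of the line. -/
structure IsCantorSet (E : Set ℝ) : Prop where
  nonempty : E.Nonempty
  bounded : Bornology.IsBounded E
  perfect : Perfect E
  nowhereDense : IsNowhereDense E

/-- `G` is a connected component of the subset `E` of the line. -/
def IsComponentOf (E G : Set ℝ) : Prop :=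
  ∃ x ∈ E, G = connectedComponentIn E x

/-- A gap of `E`: a bounded connected component of the complement of `E`. -/
def IsGap (E G : Set ℝ) : Prop :=
  IsComponentOf Eᶜ G ∧ Bornology.IsBounded G

/-- A proper component of `E`: a connected component of `E` that is not a singleton. -/
def IsProperComponent (E G : Set ℝ) : Prop :=
  IsComponentOf E G ∧ G.Nontrivial

/-- The point `x` is accumulated by gaps and by proper components of `E`: each neighbourhood
`(x - ε, x + ε)` contains a gap of `E` and a proper component of `E`. (If `x` is an endpoint of a
gap, that gap itself and a component ending at `x` are not contained in it for small `ε`.) -/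
def IsAccumulated (E : Set ℝ) (x : ℝ) : Prop :=
  ∀ ε > 0, (∃ G, IsGap E G ∧ G ⊆ Set.Ioo (x - ε) (x + ε)) ∧
    ∃ K, IsProperComponent E K ∧ K ⊆ Set.Ioo (x - ε) (x + ε)

/-- An M-Cantorval: a perfect set with infinitely many gaps such that both endpoints of any gap
are accumulated by gaps and proper components. (A gap is a nonempty bounded interval, with
endpoints its infimum and its supremum.) -/
structure IsMCantorval (E : Set ℝ) : Prop where
  perfect : Perfect E
  infinite_gaps : {G : Set ℝ | IsGap E G}.Infinite
  accumulated : ∀ G, IsGap E G → IsAccumulated E (sInf G) ∧ IsAccumulated E (sSup G)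

/-! The set D satisfies pD = D + B, where B is the set of differences of digits: all d with |d| ≤ l
- 1 or p - 2l + 1 ≤ |d| ≤ p - 1. Everything is read off from B and from D ⊆ [-1, 1], through three
thresholds.

If p ≤ 3l, no two consecutive integers of [0, p - 1] are missing from B, so every x in [-1, 1] has a
digit d with px - d in [-1, 1], and D fills the interval (`subset_of_expansion`). If 3l < p, the
interval (l/p, (p - 2l)/p) misses D.

If p < 4l, B represents all residues mod p, so D + ℤ is the whole line and Baire gives D interior
(`interior_nonempty`). If 4l ≤ p, the residue of 2l is missing, some point lies in no integer
translate of D, and rescaling rules out interior (`interior_eq_empty`). As D is always perfect, it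
is then a Cantor set.

For 3l < p < 4l, D has both interior and a hole in (0, 1). Self-similarity spreads intervals near
every point of D, and `exists_notMem_left_of_gap` shows that no gap is adjacent to an interval of D.
Together these make gap endpoints accumulated by gaps and by proper components. -/

/-- `D` is the compact attractor of the maps `x ↦ (x + d) / p`, `d ∈ B`, and is contained in
`[-1, 1]`, with both endpoints and the centre in `D`. -/
structure IsCenteredAttractor (p : ℕ) (B : Set ℤ) (D : Set ℝ) : Prop where
  two_lt : 2 < p
  isCompact : IsCompact D
  mem_iff : ∀ x, x ∈ D ↔ ∃ d ∈ B, (p : ℝ) * x - (d : ℝ) ∈ D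
  subset_Icc : D ⊆ Set.Icc (-1) 1
  zero_mem : (0 : ℝ) ∈ D
  one_mem : (1 : ℝ) ∈ D
  neg_mem : ∀ x ∈ D, -x ∈ D

/-! ### Digit expansions and the difference set as an attractor -/

section DigitSet

lemma mem_digitSet_iff {p : ℕ} (hp : 0 < p) (A : Set ℤ) (x : ℝ) :
    x ∈ digitSet p A ↔ ∃ d ∈ A, (p : ℝ) * x - (d : ℝ) ∈ digitSet p A := by
  have hp0 : (p : ℝ) ≠ 0 := by positivity
  constructor
  · rintro ⟨d, hd, hs⟩
    refine ⟨d 0, hd 0, fun i => d (i + 1), fun i => hd _, ?_⟩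
    have h1 := ((hasSum_nat_add_iff' (f := fun i : ℕ => (d i : ℝ) / (p : ℝ) ^ (i + 1)) 1).2
      hs).mul_left (p : ℝ)
    have e1 : (fun i : ℕ => (p : ℝ) * ((d (i + 1) : ℝ) / (p : ℝ) ^ (i + 1 + 1))) =
        fun i => (d (i + 1) : ℝ) / (p : ℝ) ^ (i + 1) := by
      funext i
      rw [pow_succ _ (i + 1)]
      field_simp
    have e2 : (p : ℝ) * (x - ∑ i ∈ Finset.range 1, (d i : ℝ) / (p : ℝ) ^ (i + 1)) =
        p * x - d 0 := by
      simp
      field_simp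
    rwa [e1, e2] at h1
  · rintro ⟨a, ha, d, hd, hs⟩
    refine ⟨fun i => Nat.casesOn i a d, fun i => by cases i <;> simp [ha, hd], ?_⟩
    rw [← hasSum_nat_add_iff' 1]
    have h1 := hs.div_const (p : ℝ)
    have e1 : (fun i : ℕ => (d i : ℝ) / (p : ℝ) ^ (i + 1) / p) =
        fun i => (d i : ℝ) / (p : ℝ) ^ (i + 1 + 1) := by
      funext i
      rw [pow_succ _ (i + 1), div_div]
    have e2 : ((p : ℝ) * x - a) / p = x - a / p := by
      field_simp
    rw [e1, e2] at h1
    simpa using h1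

lemma hasSum_geometric_digits {p : ℕ} (hp : 1 < p) (c : ℝ) :
    HasSum (fun i : ℕ => c / (p : ℝ) ^ (i + 1)) (c / (p - 1)) := by
  have hp1 : (1 : ℝ) < p := by exact_mod_cast hp
  have h := (hasSum_geometric_of_lt_one (r := (p : ℝ)⁻¹) (by positivity)
    (inv_lt_one_of_one_lt₀ hp1)).mul_left (c / p)
  have h1 : (p : ℝ) - 1 ≠ 0 := by linarith
  have h2 : (1 : ℝ) - (p : ℝ)⁻¹ ≠ 0 := by
    have := inv_lt_one_of_one_lt₀ hp1
    linarith
  have e1 : (fun i : ℕ => c / (p : ℝ) * (p : ℝ)⁻¹ ^ i) = fun i => c / (p : ℝ) ^ (i + 1) := by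
    funext i
    rw [inv_pow, pow_succ]
    field_simp
  have e2 : c / (p : ℝ) * (1 - (p : ℝ)⁻¹)⁻¹ = c / (p - 1) := by
    have e3 : (p : ℝ) - 1 = p * (1 - (p : ℝ)⁻¹) := by field_simp
    rw [e3, ← div_div, div_eq_mul_inv _ (1 - (p : ℝ)⁻¹)]
  rwa [e1, e2] at h

lemma div_mem_digitSet {p : ℕ} (hp : 1 < p) {A : Set ℤ} {c : ℤ} (hc : c ∈ A) :
    (c : ℝ) / (p - 1) ∈ digitSet p A :=
  ⟨fun _ => c, fun _ => hc, hasSum_geometric_digits hp c⟩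

lemma digitSet_subset_Icc {p : ℕ} (hp : 1 < p) {A : Set ℤ} {a b : ℤ} (hA : A ⊆ Set.Icc a b) :
    digitSet p A ⊆ Set.Icc ((a : ℝ) / (p - 1)) ((b : ℝ) / (p - 1)) := by
  rintro x ⟨d, hd, hs⟩
  constructor
  · refine hasSum_le (fun i => ?_) (hasSum_geometric_digits hp a) hs
    have : (a : ℝ) ≤ d i := by exact_mod_cast (hA (hd i)).1
    gcongr
  · refine hasSum_le (fun i => ?_) hs (hasSum_geometric_digits hp b)
    have : (d i : ℝ) ≤ b := by exact_mod_cast (hA (hd i)).2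
    gcongr

/-- The set is the image of the compact product of finite discrete digit sets under the uniformly
convergent sum. -/
lemma isCompact_digitSet {p : ℕ} (hp : 1 < p) {A : Set ℤ} (hA : A.Finite) :
    IsCompact (digitSet p A) := by
  obtain ⟨M, hM⟩ : ∃ M : ℝ, ∀ a ∈ A, |(a : ℝ)| ≤ M := by
    obtain ⟨M, hM⟩ := (hA.image (fun a : ℤ => |(a : ℝ)|)).bddAbove
    exact ⟨M, fun a ha => hM ⟨a, ha, rfl⟩⟩
  have : Finite A := hA
  have hbound : ∀ (i : ℕ) (d : ℕ → A), ‖((d i : ℤ) : ℝ) / (p : ℝ) ^ (i + 1)‖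
      ≤ M / (p : ℝ) ^ (i + 1) := by
    intro i d
    rw [Real.norm_eq_abs, abs_div, abs_of_nonneg (by positivity : (0 : ℝ) ≤ (p : ℝ) ^ (i + 1))]
    have := hM _ (d i).2
    gcongr
  have hsum : Summable (fun i : ℕ => M / (p : ℝ) ^ (i + 1)) :=
    (hasSum_geometric_digits hp M).summable
  have hcont : Continuous (fun d : ℕ → A => ∑' i : ℕ, ((d i : ℤ) : ℝ) / (p : ℝ) ^ (i + 1)) := by
    refine continuous_tsum (fun i => ?_) hsum hbound
    have h1 : Continuous (fun a : A => ((a : ℤ) : ℝ)) := continuous_of_discreteTopology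
    exact (h1.comp (continuous_apply i)).div_const _
  convert isCompact_range hcont using 1
  ext x
  constructor
  · rintro ⟨d, hd, hs⟩
    exact ⟨fun i => ⟨d i, hd i⟩, hs.tsum_eq⟩
  · rintro ⟨d, rfl⟩
    refine ⟨fun i => d i, fun i => (d i).2, Summable.hasSum ?_⟩
    exact Summable.of_norm_bounded hsum (fun i => hbound i d)

lemma mem_sDigits_sub_sDigits_iff {l p : ℕ} (hl : 1 ≤ l) (hlp : 2 * l < p) (d : ℤ) :
    d ∈ sDigits l l p - sDigits l l p ↔
      |d| ≤ l - 1 ∨ ((p : ℤ) - 2 * l + 1 ≤ |d| ∧ |d| ≤ p - 1) := by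
  simp only [Set.mem_sub, sDigits, Set.mem_union, Set.mem_Icc]
  constructor
  · rintro ⟨a, ha, b, hb, rfl⟩
    rcases abs_cases (a - b) with h | h <;> omega
  · intro h
    rcases abs_cases d with h0 | h0
    · by_cases h1 : d ≤ l - 1 ∨ (p : ℤ) - l ≤ d
      · exact ⟨d, by omega, 0, by omega, by omega⟩
      -- Here p - 2l + 1 ≤ d < p - l, so subtracting d from the least large digit p - l leaves a
      -- small digit.
      · exact ⟨p - l, by omega, p - l - d, by omega, by omega⟩
    · by_cases h1 : -d ≤ l - 1 ∨ (p : ℤ) - l ≤ -d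
      · exact ⟨0, by omega, -d, by omega, by omega⟩
      · exact ⟨p - l + d, by omega, p - l, by omega, by omega⟩

lemma isCenteredAttractor_symmSCantorSet {l p : ℕ} (hl : 1 ≤ l) (hp : 2 < p) (hlp : 2 * l < p) :
    IsCenteredAttractor p (sDigits l l p - sDigits l l p)
      (symmSCantorSet l p - symmSCantorSet l p) := by
  have hp1 : (0 : ℝ) < (p : ℝ) - 1 := by
    have : (2 : ℝ) < p := by exact_mod_cast hp
    linarith
  have hsub : sDigits l l p ⊆ Set.Icc (0 : ℤ) ((p : ℤ) - 1) := by
    intro x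
    simp only [sDigits, Set.mem_union, Set.mem_Icc]
    omega
  have hC : symmSCantorSet l p ⊆ Set.Icc 0 1 := by
    have := digitSet_subset_Icc (p := p) (by omega) hsub
    push_cast at this
    rwa [zero_div, div_self hp1.ne'] at this
  have h0 : (0 : ℝ) ∈ symmSCantorSet l p := by
    have := div_mem_digitSet (p := p) (A := sDigits l l p) (c := 0) (by omega)
      (by simp only [sDigits, Set.mem_union, Set.mem_Icc]; omega)
    push_cast at this
    rwa [zero_div] at this
  have h1 : (1 : ℝ) ∈ symmSCantorSet l p := by
    have := div_mem_digitSet (p := p) (A := sDigits l l p) (c := p - 1) (by omega)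
      (by simp only [sDigits, Set.mem_union, Set.mem_Icc]; omega)
    push_cast at this
    rwa [div_self hp1.ne'] at this
  have hcpt : IsCompact (symmSCantorSet l p) :=
    isCompact_digitSet (by omega) ((Set.finite_Icc _ _).subset hsub)
  have hmem : ∀ x, x ∈ symmSCantorSet l p ↔
      ∃ d ∈ sDigits l l p, (p : ℝ) * x - (d : ℝ) ∈ symmSCantorSet l p :=
    mem_digitSet_iff (by omega) _
  have hp0 : (p : ℝ) ≠ 0 := by positivity
  refine ⟨hp, sub_eq_add_neg (symmSCantorSet l p) _ ▸ hcpt.add hcpt.neg, ?_, ?_,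
    ⟨0, h0, 0, h0, sub_zero 0⟩, ⟨1, h1, 0, h0, sub_zero 1⟩, ?_⟩
  · intro x
    constructor
    · rintro ⟨u, hu, v, hv, rfl⟩
      obtain ⟨a, ha, hu'⟩ := (hmem u).1 hu
      obtain ⟨b, hb, hv'⟩ := (hmem v).1 hv
      refine ⟨a - b, ⟨a, ha, b, hb, rfl⟩, _, hu', _, hv', ?_⟩
      push_cast
      ring
    · rintro ⟨_, ⟨a, ha, b, hb, rfl⟩, u, hu, v, hv, h⟩
      refine ⟨(u + a) / p, (hmem _).2 ⟨a, ha, ?_⟩, (v + b) / p, (hmem _).2 ⟨b, hb, ?_⟩, ?_⟩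
      · convert hu using 1
        field_simp
        ring
      · convert hv using 1
        field_simp
        ring
      · push_cast at h
        field_simp
        linarith
  · rintro _ ⟨u, hu, v, hv, rfl⟩
    have := hC hu
    have := hC hv
    simp only [Set.mem_Icc] at *
    constructor <;> linarith
  · rintro _ ⟨u, hu, v, hv, rfl⟩
    exact ⟨v, hv, u, hu, (neg_sub u v).symm⟩

end DigitSet

/-! ### Self-similarity: perfectness, interior, and the sides of a gap -/

namespace IsCenteredAttractor

variable {p : ℕ} {B : Set ℤ} {D : Set ℝ}

lemma one_lt_cast (h : IsCenteredAttractor p B D) : (1 : ℝ) < p := by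
  exact_mod_cast (by have := h.two_lt; omega : 1 < p)

lemma pow_pos (h : IsCenteredAttractor p B D) (n : ℕ) : (0 : ℝ) < (p : ℝ) ^ n :=
  _root_.pow_pos (zero_lt_one.trans h.one_lt_cast) n

lemma isClosed (h : IsCenteredAttractor p B D) : IsClosed D := h.isCompact.isClosed

lemma abs_le_one (h : IsCenteredAttractor p B D) {x : ℝ} (hx : x ∈ D) : |x| ≤ 1 :=
  abs_le.2 (h.subset_Icc hx)

lemma add_div_mem (h : IsCenteredAttractor p B D) {d : ℤ} (hd : d ∈ B) {y : ℝ} (hy : y ∈ D) :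
    (d + y) / p ∈ D := by
  have := h.one_lt_cast
  refine (h.mem_iff _).2 ⟨d, hd, ?_⟩
  convert hy using 1
  field_simp
  ring

/-- Every point of `D` lies in a copy of `D` scaled by `p ^ n` and translated by an integer. -/
lemma exists_copy (h : IsCenteredAttractor p B D) (n : ℕ) {x : ℝ} (hx : x ∈ D) :
    ∃ N : ℤ, (p : ℝ) ^ n * x - N ∈ D ∧ ∀ y ∈ D, (N + y) / (p : ℝ) ^ n ∈ D := by
  have hp := h.one_lt_cast
  induction n with
  | zero => exact ⟨0, by simpa using hx, fun y hy => by simpa using hy⟩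
  | succ n ih =>
    obtain ⟨N, hN, hcopy⟩ := ih
    obtain ⟨d, hd, hdD⟩ := (h.mem_iff _).1 hN
    refine ⟨p * N + d, ?_, fun y hy => ?_⟩
    · convert hdD using 1
      push_cast
      ring
    · convert hcopy _ (h.add_div_mem hd hy) using 1
      push_cast
      field_simp
      ring

lemma exists_pow_gt (h : IsCenteredAttractor p B D) {ε : ℝ} (hε : 0 < ε) (C : ℝ) :
    ∃ n : ℕ, C < (p : ℝ) ^ n * ε := by
  obtain ⟨n, hn⟩ := pow_unbounded_of_one_lt (C / ε) h.one_lt_cast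
  exact ⟨n, (div_lt_iff₀ hε).1 hn⟩

/-- Arbitrarily small copies of `D` can be found near each of its points. -/
lemma exists_small_copy (h : IsCenteredAttractor p B D) {x : ℝ} (hx : x ∈ D) {ε : ℝ}
    (hε : 0 < ε) : ∃ (n : ℕ) (N : ℤ), ∀ y ∈ D, (N + y) / (p : ℝ) ^ n ∈ D ∧
      |(N + y) / (p : ℝ) ^ n - x| < ε := by
  obtain ⟨n, hn⟩ := h.exists_pow_gt hε 2
  obtain ⟨N, hN, hcopy⟩ := h.exists_copy n hx
  refine ⟨n, N, fun y hy => ⟨hcopy y hy, ?_⟩⟩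
  have hpn := h.pow_pos n
  have e : (N + y) / (p : ℝ) ^ n - x = (y - ((p : ℝ) ^ n * x - N)) / (p : ℝ) ^ n := by
    field_simp
    ring
  rw [e, abs_div, abs_of_pos hpn, div_lt_iff₀ hpn]
  calc _ ≤ |y| + |(p : ℝ) ^ n * x - N| := abs_sub _ _
    _ ≤ 1 + 1 := add_le_add (h.abs_le_one hy) (h.abs_le_one hN)
    _ < _ := by linarith

lemma exists_ne_mem (h : IsCenteredAttractor p B D) {x : ℝ} (hx : x ∈ D) {ε : ℝ}
    (hε : 0 < ε) : ∃ y ∈ D, y ≠ x ∧ |y - x| < ε := by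
  obtain ⟨n, N, hc⟩ := h.exists_small_copy hx hε
  obtain ⟨h0, h0'⟩ := hc 0 h.zero_mem
  obtain ⟨h1, h1'⟩ := hc 1 h.one_mem
  by_cases hx0 : (N + 0) / (p : ℝ) ^ n = x
  · refine ⟨_, h1, fun hx1 => ?_, h1'⟩
    have := (div_left_inj' (h.pow_pos n).ne').1 (hx0.trans hx1.symm)
    linarith
  · exact ⟨_, h0, hx0, h0'⟩

lemma perfect (h : IsCenteredAttractor p B D) : Perfect D := by
  refine ⟨h.isClosed, fun x hx => ?_⟩
  rw [accPt_iff_nhds]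
  intro U hU
  obtain ⟨ε, hε, hball⟩ := Metric.mem_nhds_iff.1 hU
  obtain ⟨y, hy, hne, hyx⟩ := h.exists_ne_mem hx hε
  exact ⟨y, ⟨hball (by simpa [Real.dist_eq] using hyx), hy⟩, hne⟩

/-- If every point of a bounded set has an expansion step staying in the set, then the set is
contained in the attractor. -/
lemma subset_of_expansion (h : IsCenteredAttractor p B D) {F : Set ℝ} {C : ℝ}
    (hF : ∀ x ∈ F, |x| ≤ C) (hstep : ∀ x ∈ F, ∃ d ∈ B, (p : ℝ) * x - (d : ℝ) ∈ F) :
    F ⊆ D := by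
  have hp := h.one_lt_cast
  -- Expanding n times and replacing the remaining tail by 0 ∈ D costs at most C / p ^ n.
  have key : ∀ n : ℕ, ∀ x ∈ F, ∃ y ∈ D, |x - y| ≤ C / (p : ℝ) ^ n := by
    intro n
    induction n with
    | zero => exact fun x hx => ⟨0, h.zero_mem, by simpa using hF x hx⟩
    | succ n ih =>
      intro x hx
      obtain ⟨d, hd, hdF⟩ := hstep x hx
      obtain ⟨y, hy, hxy⟩ := ih _ hdF
      refine ⟨_, h.add_div_mem hd hy, ?_⟩
      have e : x - (d + y) / p = (p * x - d - y) / p := by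
        field_simp
        ring
      rw [e, abs_div, abs_of_pos (by linarith : (0 : ℝ) < p), pow_succ, ← div_div]
      gcongr
  intro x hx
  rw [← h.isClosed.closure_eq, Metric.mem_closure_iff]
  intro ε hε
  obtain ⟨n, hn⟩ := h.exists_pow_gt hε C
  obtain ⟨y, hy, hxy⟩ := key n x hx
  refine ⟨y, hy, hxy.trans_lt ?_⟩
  rw [div_lt_iff₀ (h.pow_pos n)]
  linarith

/-- If the integer translates of `D` do not cover the line, then `D` has empty interior. -/
lemma interior_eq_empty (h : IsCenteredAttractor p B D) {x : ℝ}
    (hx : ∀ k : ℤ, x + k ∉ D) : interior D = ∅ := by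
  by_contra hne
  obtain ⟨c, hc⟩ := Set.nonempty_iff_ne_empty.2 hne
  obtain ⟨ε, hε, hball⟩ := Metric.mem_nhds_iff.1 (mem_interior_iff_mem_nhds.1 hc)
  obtain ⟨n, hn⟩ := h.exists_pow_gt hε 1
  have hpn := h.pow_pos n
  -- Scaled by p ^ n, the ball is longer than 1 on each side of its centre, so it contains some x +
  -- k; the copy of D through that point exhibits an integer translate of x in D.
  set k : ℤ := round ((p : ℝ) ^ n * c - x)
  have hk : |(p : ℝ) ^ n * c - x - k| ≤ 1 / 2 := abs_sub_round _
  have hmem : (x + k) / (p : ℝ) ^ n ∈ D := by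
    apply hball
    have e : (x + k) / (p : ℝ) ^ n - c = -((p : ℝ) ^ n * c - x - k) / (p : ℝ) ^ n := by
      field_simp
      ring
    rw [Metric.mem_ball, Real.dist_eq, e, abs_div, abs_of_pos hpn, abs_neg, div_lt_iff₀ hpn]
    linarith
  obtain ⟨N, hN, -⟩ := h.exists_copy n hmem
  apply hx (k - N)
  convert hN using 1
  push_cast
  field_simp
  ring

/-- If the digits represent all residues modulo `p`, then `D` has nonempty interior. -/
lemma interior_nonempty (h : IsCenteredAttractor p B D)
    (hB : ∀ k : ℤ, ∃ d ∈ B, ∃ m : ℤ, k = d + p * m) : (interior D).Nonempty := by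
  have hp := h.one_lt_cast
  have hdense : ∀ (n : ℕ) (k : ℤ), ∃ m : ℤ, (k : ℝ) / (p : ℝ) ^ n - m ∈ D := by
    intro n
    induction n with
    | zero => exact fun k => ⟨k, by simpa using h.zero_mem⟩
    | succ n ih =>
      intro k
      obtain ⟨m, hm⟩ := ih k
      -- Writing the old integer part as d + p * m' makes d the new leading digit and m' the new
      -- integer part.
      obtain ⟨d, hd, m', rfl⟩ := hB m
      refine ⟨m', ?_⟩
      convert h.add_div_mem hd hm using 1
      push_cast
      rw [pow_succ]
      field_simp
      ring
  have hclosed : IsClosed (D + Set.range ((↑) : ℤ → ℝ)) :=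
    Int.isClosedEmbedding_coe_real.isClosed_range.add_left_of_isCompact h.isCompact
  have hcover : ∀ x : ℝ, x ∈ D + Set.range ((↑) : ℤ → ℝ) := by
    intro x
    rw [← hclosed.closure_eq, Metric.mem_closure_iff]
    intro ε hε
    obtain ⟨n, hn⟩ := h.exists_pow_gt hε 1
    have hpn := h.pow_pos n
    set k : ℤ := round ((p : ℝ) ^ n * x)
    have hk : |(p : ℝ) ^ n * x - k| ≤ 1 / 2 := abs_sub_round _
    obtain ⟨m, hm⟩ := hdense n k
    refine ⟨_, ⟨_, hm, m, ⟨m, rfl⟩, rfl⟩, ?_⟩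
    have e : x - (k / (p : ℝ) ^ n - m + m) = ((p : ℝ) ^ n * x - k) / (p : ℝ) ^ n := by
      field_simp
      ring
    rw [Real.dist_eq, e, abs_div, abs_of_pos hpn, div_lt_iff₀ hpn]
    linarith
  -- Baire: countably many closed translates of D cover the line, so one has interior.
  obtain ⟨k, x, hx⟩ := nonempty_interior_of_iUnion_of_closed
    (f := fun k : ℤ => (fun x : ℝ => x + k) ⁻¹' D)
    (fun k => h.isClosed.preimage (by fun_prop)) (by
      refine Set.eq_univ_of_forall fun x => Set.mem_iUnion.2 ?_
      obtain ⟨y, hy, _, ⟨m, rfl⟩, rfl⟩ := hcover x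
      exact ⟨-m, by simpa using hy⟩)
  have hx' : x ∈ (Homeomorph.addRight (k : ℝ)) ⁻¹' interior D := by
    rw [Homeomorph.preimage_interior]
    exact hx
  exact ⟨_, hx'⟩

/-- No gap of `D` is adjacent to an interval contained in `D`. -/
lemma exists_notMem_left_of_gap (h : IsCenteredAttractor p B D) {c : ℝ}
    (hc : c ∈ Set.Ioo (0 : ℝ) 1) (hcD : c ∉ D) {a : ℝ} (ha : a ∈ D) {ε : ℝ} (hε : 0 < ε)
    (hgap : ∀ x ∈ Set.Ioo a (a + ε), x ∉ D) : ∃ x ∈ Set.Ioo (a - ε) a, x ∉ D := by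
  by_contra! hint
  obtain ⟨n, hn⟩ := h.exists_pow_gt hε 4
  have hpn := h.pow_pos n
  obtain ⟨m, hm, hmcopy⟩ := h.exists_copy n ha
  -- At scale p ^ n the gap is longer than 4, so a copy of D that comes near a cannot have its right
  -- end beyond a.
  have hgap' : ∀ z : ℝ, z / (p : ℝ) ^ n ∈ D → z ≤ (p : ℝ) ^ n * a + 4 → z ≤ (p : ℝ) ^ n * a := by
    intro z hz hle
    by_contra! hlt
    refine hgap _ ⟨?_, ?_⟩ hz
    · rw [lt_div_iff₀ hpn]
      linarith
    · rw [div_lt_iff₀ hpn]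
      linarith
  have hma := h.subset_Icc hm
  have htop := hgap' _ (hmcopy 1 h.one_mem) (by linarith [hma.1])
  have hta : (p : ℝ) ^ n * a = m + 1 := by linarith [hma.2]
  -- The copy through a is m + D, and a is its right end. The hole c of this copy lies in the
  -- supposed interval, so another copy m' + D must fill it. But m' > m would reach into the gap,
  -- and m' < m would end before m + c; hence m' = m and c ∈ D.
  have hmem : (m + c) / (p : ℝ) ^ n ∈ D := by
    apply hint
    constructor
    · rw [lt_div_iff₀ hpn]
      linarith [hc.1]
    · rw [div_lt_iff₀ hpn]
      linarith [hc.2]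
  obtain ⟨m', hm', hcopy'⟩ := h.exists_copy n hmem
  rw [mul_div_cancel₀ _ hpn.ne'] at hm'
  have hb := h.subset_Icc hm'
  have h1 := hgap' _ (hcopy' 1 h.one_mem) (by linarith [hb.1, hc.2])
  have hle : m' ≤ m := by
    rw [hta] at h1
    exact_mod_cast (by linarith : (m' : ℝ) ≤ m)
  have hge : m ≤ m' := by
    have : (m : ℝ) < m' + 1 := by linarith [hb.2, hc.1]
    exact Int.lt_add_one_iff.1 (by exact_mod_cast this)
  obtain rfl := le_antisymm hle hge
  apply hcD
  convert hm' using 1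
  ring

/-- If `D` has nonempty interior, then each of its points is a limit of intervals in `D`. -/
lemma exists_Ioo_subset (h : IsCenteredAttractor p B D) (hne : (interior D).Nonempty) {x : ℝ}
    (hx : x ∈ D) {ε : ℝ} (hε : 0 < ε) :
    ∃ u v, u < v ∧ Set.Ioo u v ⊆ D ∩ Set.Ioo (x - ε) (x + ε) := by
  obtain ⟨c, hc⟩ := hne
  obtain ⟨δ, hδ, hball⟩ := Metric.mem_nhds_iff.1 (mem_interior_iff_mem_nhds.1 hc)
  obtain ⟨n, N, hcopy⟩ := h.exists_small_copy hx hε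
  have hpn := h.pow_pos n
  refine ⟨(N + (c - δ)) / (p : ℝ) ^ n, (N + (c + δ)) / (p : ℝ) ^ n, ?_, ?_⟩
  · gcongr
    linarith
  · rintro y ⟨h1, h2⟩
    rw [div_lt_iff₀ hpn] at h1
    rw [lt_div_iff₀ hpn] at h2
    obtain ⟨h3, h4⟩ := hcopy (y * (p : ℝ) ^ n - N) (hball (by
      rw [Metric.mem_ball, Real.dist_eq, abs_lt]
      constructor <;> linarith))
    rw [add_sub_cancel, mul_div_cancel_right₀ _ hpn.ne'] at h3 h4
    rw [abs_lt] at h4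
    exact ⟨h3, by linarith, by linarith⟩

end IsCenteredAttractor

/-! ### Components and gaps of subsets of the line -/

lemma connectedComponentIn_subset_Ioi {S : Set ℝ} {x c : ℝ} (hx : x ∉ S) (hxc : x < c) :
    connectedComponentIn S c ⊆ Set.Ioi x := by
  intro y hy
  by_contra! hle
  have hc : c ∈ connectedComponentIn S c :=
    mem_connectedComponentIn (connectedComponentIn_nonempty_iff.1 ⟨y, hy⟩)
  exact hx (connectedComponentIn_subset S c
    (isPreconnected_connectedComponentIn.ordConnected.out hy hc ⟨not_lt.1 hle, hxc.le⟩))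

lemma connectedComponentIn_subset_Iio {S : Set ℝ} {x c : ℝ} (hx : x ∉ S) (hxc : c < x) :
    connectedComponentIn S c ⊆ Set.Iio x := by
  intro y hy
  by_contra! hle
  have hc : c ∈ connectedComponentIn S c :=
    mem_connectedComponentIn (connectedComponentIn_nonempty_iff.1 ⟨y, hy⟩)
  exact hx (connectedComponentIn_subset S c
    (isPreconnected_connectedComponentIn.ordConnected.out hc hy ⟨hxc.le, not_lt.1 hle⟩))

lemma connectedComponentIn_subset_Ioo {S : Set ℝ} {x c y : ℝ} (hx : x ∉ S) (hxc : x < c)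
    (hy : y ∉ S) (hcy : c < y) : connectedComponentIn S c ⊆ Set.Ioo x y := fun _ hz =>
  ⟨connectedComponentIn_subset_Ioi hx hxc hz, connectedComponentIn_subset_Iio hy hcy hz⟩

lemma exists_isGap_subset_Ioo {E : Set ℝ} {x c y : ℝ} (hx : x ∈ E) (hxc : x < c) (hc : c ∉ E)
    (hy : y ∈ E) (hcy : c < y) : ∃ G, IsGap E G ∧ G ⊆ Set.Ioo x y := by
  have hsub : connectedComponentIn Eᶜ c ⊆ Set.Ioo x y :=
    connectedComponentIn_subset_Ioo (not_not.2 hx) hxc (not_not.2 hy) hcy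
  exact ⟨_, ⟨⟨c, hc, rfl⟩, (Metric.isBounded_Ioo x y).subset hsub⟩, hsub⟩

lemma exists_isProperComponent_subset_Ioo {E : Set ℝ} {x u v y : ℝ} (hx : x ∉ E) (hxu : x ≤ u)
    (huv : u < v) (huvE : Set.Ioo u v ⊆ E) (hy : y ∉ E) (hvy : v ≤ y) :
    ∃ K, IsProperComponent E K ∧ K ⊆ Set.Ioo x y := by
  obtain ⟨s, hus, hsv⟩ := exists_between huv
  obtain ⟨t, hst, htv⟩ := exists_between hsv
  have hs : s ∈ Set.Ioo u v := ⟨hus, hsv⟩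
  have hsub : Set.Ioo u v ⊆ connectedComponentIn E s :=
    isPreconnected_Ioo.subset_connectedComponentIn hs huvE
  exact ⟨_, ⟨⟨s, huvE hs, rfl⟩, ⟨s, hsub hs, t, hsub ⟨hus.trans hst, htv⟩, hst.ne⟩⟩,
    connectedComponentIn_subset_Ioo hx (hxu.trans_lt hus) hy (hsv.trans_le hvy)⟩

lemma IsProperComponent.interior_nonempty {E K : Set ℝ} (hK : IsProperComponent E K) :
    (interior E).Nonempty := by
  obtain ⟨⟨c, -, rfl⟩, hnt⟩ := hK
  obtain ⟨x, hx, y, hy, hxy⟩ := hnt.exists_lt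
  obtain ⟨z, hz⟩ := exists_between hxy
  exact ⟨z, interior_maximal (Set.Ioo_subset_Icc_self.trans
    ((isPreconnected_connectedComponentIn.ordConnected.out hx hy).trans
      (connectedComponentIn_subset E c))) isOpen_Ioo hz⟩

namespace IsGap

variable {E G : Set ℝ}

lemma nonempty (hG : IsGap E G) : G.Nonempty := by
  obtain ⟨⟨c, hc, rfl⟩, -⟩ := hG
  exact ⟨c, mem_connectedComponentIn hc⟩

lemma subset_compl (hG : IsGap E G) : G ⊆ Eᶜ := by
  obtain ⟨⟨c, hc, rfl⟩, -⟩ := hG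
  exact connectedComponentIn_subset _ _

lemma isPreconnected (hG : IsGap E G) : IsPreconnected G := by
  obtain ⟨⟨c, hc, rfl⟩, -⟩ := hG
  exact isPreconnected_connectedComponentIn

lemma isOpen (hG : IsGap E G) (hE : IsClosed E) : IsOpen G := by
  obtain ⟨⟨c, hc, rfl⟩, -⟩ := hG
  exact hE.isOpen_compl.connectedComponentIn

/-- Otherwise adjoining the limit point would give a larger connected subset of the complement,
against maximality of the component. -/
lemma mem_of_mem_closure (hG : IsGap E G) {a : ℝ} (ha : a ∈ closure G) (haG : a ∉ G) : a ∈ E := by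
  by_contra haE
  have hpre : IsPreconnected (insert a G) :=
    hG.isPreconnected.subset_closure (Set.subset_insert a G)
      (Set.insert_subset ha subset_closure)
  obtain ⟨⟨c, hc, rfl⟩, -⟩ := id hG
  exact haG (hpre.subset_connectedComponentIn
    (Set.mem_insert_of_mem _ (mem_connectedComponentIn hc))
    (Set.insert_subset haE hG.subset_compl) (Set.mem_insert a _))

lemma sInf_mem (hG : IsGap E G) (hE : IsClosed E) : sInf G ∈ E := by
  refine hG.mem_of_mem_closure (csInf_mem_closure hG.nonempty hG.2.bddBelow) fun hmem => ?_
  obtain ⟨ε, hε, hball⟩ := Metric.isOpen_iff.1 (hG.isOpen hE) _ hmem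
  have := csInf_le hG.2.bddBelow (hball (show sInf G - ε / 2 ∈ Metric.ball (sInf G) ε by
    rw [Metric.mem_ball, Real.dist_eq, abs_lt]
    constructor <;> linarith))
  linarith

lemma Ioo_subset (hG : IsGap E G) : Set.Ioo (sInf G) (sSup G) ⊆ G := by
  rintro x ⟨h1, h2⟩
  obtain ⟨u, hu, hux⟩ := exists_lt_of_csInf_lt hG.nonempty h1
  obtain ⟨v, hv, hxv⟩ := exists_lt_of_lt_csSup hG.nonempty h2
  exact hG.isPreconnected.ordConnected.out hu hv ⟨hux.le, hxv.le⟩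

lemma sInf_lt_sSup (hG : IsGap E G) (hE : IsClosed E) : sInf G < sSup G := by
  obtain ⟨g, hg⟩ := hG.nonempty
  have h1 := csInf_le hG.2.bddBelow hg
  have h2 := le_csSup hG.2.bddAbove hg
  refine (h1.trans h2).lt_of_ne fun heq => hG.subset_compl hg ?_
  rw [show g = sInf G by linarith]
  exact hG.sInf_mem hE

end IsGap

/-- Every component of the complement contains an unbounded ray. This separates the interval case
from the M-Cantorvals. -/
lemma not_isGap_Icc {a b : ℝ} (G : Set ℝ) : ¬ IsGap (Set.Icc a b) G := by
  rintro ⟨⟨c, hc, rfl⟩, hbd⟩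
  have hc' : c < a ∨ b < c := by
    by_contra! hcon
    exact hc hcon
  rcases hc' with hca | hbc
  · have hsub : Set.Iic c ⊆ connectedComponentIn (Set.Icc a b)ᶜ c :=
      isPreconnected_Iic.subset_connectedComponentIn Set.self_mem_Iic
        fun x hx hx' => absurd (hx'.1.trans hx) (not_le.2 hca)
    exact not_bddBelow_Iic c (hbd.subset hsub).bddBelow
  · have hsub : Set.Ici c ⊆ connectedComponentIn (Set.Icc a b)ᶜ c :=
      isPreconnected_Ici.subset_connectedComponentIn Set.self_mem_Ici
        fun x hx hx' => absurd (hx.trans hx'.2) (not_le.2 hbc)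
    exact not_bddAbove_Ici c (hbd.subset hsub).bddAbove

/-- A point of `E` accumulated by gaps forces infinitely many gaps. -/
lemma IsAccumulated.infinite_gaps {E : Set ℝ} {a : ℝ} (h : IsAccumulated E a) (ha : a ∈ E) :
    {G : Set ℝ | IsGap E G}.Infinite := by
  intro hfin
  choose! g hg using fun (G : Set ℝ) (hG : IsGap E G) => hG.nonempty
  have hnhds : (g '' {G : Set ℝ | IsGap E G})ᶜ ∈ nhds a := by
    refine (hfin.image g).isClosed.isOpen_compl.mem_nhds ?_
    rintro ⟨G, hG, rfl⟩
    exact hG.subset_compl (hg G hG) ha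
  obtain ⟨ε, hε, hball⟩ := Metric.mem_nhds_iff.1 hnhds
  obtain ⟨⟨G, hG, hGs⟩, -⟩ := h ε hε
  rw [Real.ball_eq_Ioo] at hball
  exact hball (hGs (hg G hG)) ⟨G, hG, rfl⟩

/-! ### Accumulation at gap endpoints, and the two topological types -/

namespace IsCenteredAttractor

variable {p : ℕ} {B : Set ℤ} {D : Set ℝ}

/-- Just left of the endpoint a one finds c0 < x0 < c1 < a with x0 ∈ D and c0, c1 ∉ D. A gap around
c1 is trapped between x0 and a, and a proper component near x0 between c0 and c1. -/
lemma isAccumulated_sInf (h : IsCenteredAttractor p B D) (hne : (interior D).Nonempty) {c : ℝ}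
    (hc : c ∈ Set.Ioo (0 : ℝ) 1) (hcD : c ∉ D) {G : Set ℝ} (hG : IsGap D G) :
    IsAccumulated D (sInf G) := by
  intro ε hε
  have haD := hG.sInf_mem h.isClosed
  have hlt := hG.sInf_lt_sSup h.isClosed
  have hfree : ∀ x ∈ Set.Ioo (sInf G) (sSup G), x ∉ D := fun x hx =>
    hG.subset_compl (hG.Ioo_subset hx)
  set a := sInf G
  have hstep : ∀ δ > 0, ∃ x ∈ Set.Ioo (a - δ) a, x ∉ D := by
    intro δ hδ
    have hm : 0 < min δ (sSup G - a) := lt_min hδ (sub_pos.2 hlt)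
    obtain ⟨x, hx, hxD⟩ := h.exists_notMem_left_of_gap hc hcD haD hm
      fun x hx => hfree x ⟨hx.1, by linarith [hx.2, min_le_right δ (sSup G - a)]⟩
    exact ⟨x, ⟨by linarith [hx.1, min_le_left δ (sSup G - a)], hx.2⟩, hxD⟩
  obtain ⟨c0, hc0, hc0D⟩ := hstep ε hε
  obtain ⟨x0, hx0D, hx0ne, hx0⟩ := h.exists_ne_mem haD
    (lt_min (sub_pos.2 hc0.2) (sub_pos.2 hlt))
  rw [abs_lt] at hx0
  have h1 : c0 < x0 := by linarith [hx0.1, min_le_left (a - c0) (sSup G - a)]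
  have h2 : x0 < a := by
    by_contra! hle
    exact hfree x0 ⟨lt_of_le_of_ne hle hx0ne.symm,
      by linarith [hx0.2, min_le_right (a - c0) (sSup G - a)]⟩ hx0D
  obtain ⟨c1, hc1, hc1D⟩ := hstep (a - x0) (by linarith)
  have h3 : x0 < c1 := by linarith [hc1.1]
  constructor
  · obtain ⟨G', hG', hsub⟩ := exists_isGap_subset_Ioo hx0D h3 hc1D haD hc1.2
    exact ⟨G', hG', hsub.trans (Set.Ioo_subset_Ioo (by linarith [hc0.1]) (by linarith))⟩
  · obtain ⟨u, v, huv, hsub⟩ := h.exists_Ioo_subset hne hx0D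
      (lt_min (sub_pos.2 h1) (sub_pos.2 h3))
    rw [Set.subset_inter_iff, Set.Ioo_subset_Ioo_iff huv] at hsub
    obtain ⟨K, hK, hKs⟩ := exists_isProperComponent_subset_Ioo hc0D
      (by linarith [hsub.2.1, min_le_left (x0 - c0) (c1 - x0)]) huv hsub.1 hc1D
      (by linarith [hsub.2.2, min_le_right (x0 - c0) (c1 - x0)])
    exact ⟨K, hK, hKs.trans (Set.Ioo_subset_Ioo (by linarith [hc0.1]) (by linarith [hc1.2]))⟩

end IsCenteredAttractor

lemma IsComponentOf.neg {E G : Set ℝ} (h : IsComponentOf E G) : IsComponentOf (-E) (-G) := by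
  obtain ⟨x, hx, rfl⟩ := h
  refine ⟨-x, by simpa using hx, ?_⟩
  have := (Homeomorph.neg ℝ).image_connectedComponentIn hx
  simpa only [Homeomorph.coe_neg, Set.image_neg_eq_neg] using this

lemma IsGap.neg {E G : Set ℝ} (h : IsGap E G) : IsGap (-E) (-G) :=
  ⟨by simpa only [Set.compl_neg] using h.1.neg, h.2.neg⟩

lemma IsProperComponent.neg {E K : Set ℝ} (h : IsProperComponent E K) :
    IsProperComponent (-E) (-K) :=
  ⟨h.1.neg, by simpa only [Set.image_neg_eq_neg] using h.2.image neg_injective⟩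

lemma IsAccumulated.neg {E : Set ℝ} {x : ℝ} (h : IsAccumulated E x) : IsAccumulated (-E) (-x) := by
  intro ε hε
  have hsub : ∀ {S : Set ℝ}, S ⊆ Set.Ioo (x - ε) (x + ε) → -S ⊆ Set.Ioo (-x - ε) (-x + ε) := by
    intro S hS y hy
    have := hS hy
    exact ⟨by linarith [this.2], by linarith [this.1]⟩
  obtain ⟨⟨G, hG, hGs⟩, K, hK, hKs⟩ := h ε hε
  exact ⟨⟨-G, hG.neg, hsub hGs⟩, -K, hK.neg, hsub hKs⟩

namespace IsCenteredAttractor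

variable {p : ℕ} {B : Set ℤ} {D : Set ℝ}

lemma neg_eq (h : IsCenteredAttractor p B D) : -D = D := by
  ext x
  exact ⟨fun hx => by simpa using h.neg_mem _ hx, fun hx => h.neg_mem x hx⟩

lemma isMCantorval (h : IsCenteredAttractor p B D) (hne : (interior D).Nonempty) {c : ℝ}
    (hc : c ∈ Set.Ioo (0 : ℝ) 1) (hcD : c ∉ D) : IsMCantorval D := by
  refine ⟨h.perfect, ?_, fun G hG => ⟨h.isAccumulated_sInf hne hc hcD hG, ?_⟩⟩
  · obtain ⟨G, hG, -⟩ := exists_isGap_subset_Ioo h.zero_mem hc.1 hcD h.one_mem hc.2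
    exact (h.isAccumulated_sInf hne hc hcD hG).infinite_gaps (hG.sInf_mem h.isClosed)
  -- The symmetry D = -D turns right endpoints of gaps into left ones.
  · have hG' := hG.neg
    rw [h.neg_eq] at hG'
    have := (h.isAccumulated_sInf hne hc hcD hG').neg
    rwa [h.neg_eq, Real.sInf_neg, neg_neg] at this

lemma isCantorSet (h : IsCenteredAttractor p B D) (hint : interior D = ∅) : IsCantorSet D :=
  ⟨⟨0, h.zero_mem⟩, h.isCompact.isBounded, h.perfect, h.isClosed.isNowhereDense_iff.2 hint⟩

end IsCenteredAttractor

namespace IsMCantorval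

variable {E : Set ℝ}

lemma exists_isGap (h : IsMCantorval E) : ∃ G, IsGap E G := h.infinite_gaps.nonempty

lemma interior_nonempty (h : IsMCantorval E) : (interior E).Nonempty := by
  obtain ⟨G, hG⟩ := h.exists_isGap
  obtain ⟨-, K, hK, -⟩ := (h.accumulated G hG).1 1 one_pos
  exact hK.interior_nonempty

end IsMCantorval

/-! ### The thresholds 1/3 and 1/4 -/

section SymmSCantorSet

variable {l p : ℕ}

lemma symmSCantorSet_sub_self_eq_Icc (hl : 1 ≤ l) (hp : 2 < p) (hlp : 2 * l < p)
    (h3 : p ≤ 3 * l) : symmSCantorSet l p - symmSCantorSet l p = Set.Icc (-1 : ℝ) 1 := by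
  have h := isCenteredAttractor_symmSCantorSet hl hp hlp
  refine h.subset_Icc.antisymm (h.subset_of_expansion (C := 1) (fun x hx => abs_le.2 hx) ?_)
  have hp0 : (0 : ℝ) < p := by positivity
  intro x hx
  obtain ⟨k, hk⟩ : ∃ k : ℤ, k = ⌊(p : ℝ) * x⌋ := ⟨_, rfl⟩
  have hk1 : (k : ℝ) ≤ p * x := hk ▸ Int.floor_le _
  have hk2 : (p : ℝ) * x < k + 1 := hk ▸ Int.lt_floor_add_one _
  have hkle : k ≤ p := by
    have : (k : ℝ) ≤ p := by nlinarith [hx.2]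
    exact_mod_cast this
  have hkge : -(p : ℤ) ≤ k := by
    have : (-(p : ℤ) : ℝ) < ((k + 1 : ℤ) : ℝ) := by push_cast; nlinarith [hx.1]
    have : -(p : ℤ) < k + 1 := by exact_mod_cast this
    omega
  -- The nonnegative integers below p missing from B are l, …, p - 2l, at most one when p ≤ 3l. So k
  -- or k + 1 works, except at k = p, where x = 1 and the digit is p - 1.
  have hd : ∃ d ∈ sDigits l l p - sDigits l l p, d = k ∨ d = k + 1 ∨ (k = p ∧ d = k - 1) := by
    simp only [mem_sDigits_sub_sDigits_iff hl hlp]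
    by_cases h1 : |k| ≤ l - 1 ∨ ((p : ℤ) - 2 * l + 1 ≤ |k| ∧ |k| ≤ p - 1)
    · exact ⟨k, h1, Or.inl rfl⟩
    · by_cases h2 : k = p
      · refine ⟨k - 1, ?_, Or.inr (Or.inr ⟨h2, rfl⟩)⟩
        rw [abs_of_nonneg (by omega)]
        omega
      · refine ⟨k + 1, ?_, Or.inr (Or.inl rfl)⟩
        rcases abs_cases k with h4 | h4 <;> rcases abs_cases (k + 1) with h5 | h5 <;> omega
  obtain ⟨d, hdB, hd⟩ := hd
  refine ⟨d, hdB, ?_⟩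
  rcases hd with rfl | rfl | ⟨h1, rfl⟩
  · constructor <;> linarith
  · push_cast
    constructor <;> linarith
  · have : (p : ℝ) * x ≤ k := by
      rw [h1]
      push_cast
      nlinarith [hx.2]
    push_cast
    constructor <;> linarith

/-- A first digit d would need |px - d| ≤ 1, forcing l ≤ d ≤ p - 2l, exactly the range missing from
B. -/
lemma notMem_symmSCantorSet_sub_self (hl : 1 ≤ l) (hp : 2 < p) (hlp : 2 * l < p) {x : ℝ}
    (h1 : l < p * x) (h2 : p * x < p - 2 * l) :
    x ∉ symmSCantorSet l p - symmSCantorSet l p := by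
  have h := isCenteredAttractor_symmSCantorSet hl hp hlp
  intro hx
  obtain ⟨d, hd, hxd⟩ := (h.mem_iff x).1 hx
  obtain ⟨h3, h4⟩ := h.subset_Icc hxd
  rw [mem_sDigits_sub_sDigits_iff hl hlp] at hd
  have h5 : (l : ℤ) < d + 1 := by
    have : (l : ℝ) < d + 1 := by linarith
    exact_mod_cast this
  have h6 : d < p - 2 * l + 1 := by
    have : (d : ℝ) < p - 2 * l + 1 := by linarith
    exact_mod_cast this
  rw [abs_of_nonneg (by omega)] at hd
  omega

lemma exists_notMem_symmSCantorSet_sub_self (hl : 1 ≤ l) (hp : 2 < p) (hlp : 2 * l < p)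
    (h3 : 3 * l < p) :
    ∃ c ∈ Set.Ioo (0 : ℝ) 1, c ∉ symmSCantorSet l p - symmSCantorSet l p := by
  have h3' : (3 : ℝ) * l < p := by exact_mod_cast h3
  have hl' : (1 : ℝ) ≤ l := by exact_mod_cast hl
  have hp0 : (0 : ℝ) < p := by linarith
  have e : (p : ℝ) * ((p - l) / (2 * p)) = (p - l) / 2 := by field_simp
  -- The midpoint of (l/p, (p - 2l)/p).
  refine ⟨(p - l) / (2 * p), ⟨?_, ?_⟩, notMem_symmSCantorSet_sub_self hl hp hlp ?_ ?_⟩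
  · apply div_pos <;> linarith
  · rw [div_lt_one (by linarith)]
    linarith
  · rw [e]
    linarith
  · rw [e]
    linarith

lemma interior_symmSCantorSet_sub_self_eq_empty (hl : 1 ≤ l) (hp : 2 < p) (hlp : 2 * l < p)
    (h4 : 4 * l ≤ p) : interior (symmSCantorSet l p - symmSCantorSet l p) = ∅ := by
  have h := isCenteredAttractor_symmSCantorSet hl hp hlp
  have h4' : (4 : ℝ) * l ≤ p := by exact_mod_cast h4
  have hl' : (1 : ℝ) ≤ l := by exact_mod_cast hl
  have hp0 : (0 : ℝ) < p := by linarith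
  -- One expansion step takes a translate of this point to 3/8 or -5/8. The former lies in the hole
  -- of D, since l/p ≤ 1/4 < 3/8 < 1/2 ≤ (p - 2l)/p; the latter needs a digit congruent to 2l mod p,
  -- and neither 2l nor 2l - p is in B.
  refine h.interior_eq_empty (x := (2 * l - 1 + 3 / 8) / p) fun k hk => ?_
  obtain ⟨d, hd, hy⟩ := (h.mem_iff _).1 hk
  have e : (p : ℝ) * ((2 * l - 1 + 3 / 8) / p + k) - d =
      3 / 8 + ((2 * l - 1 + p * k - d : ℤ) : ℝ) := by
    push_cast
    field_simp
    ring
  rw [e] at hy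
  obtain ⟨j, hj⟩ : ∃ j : ℤ, j = 2 * l - 1 + p * k - d := ⟨_, rfl⟩
  rw [← hj] at hy
  obtain ⟨h5, h6⟩ := h.subset_Icc hy
  have hj1 : j < 1 := by
    have : (j : ℝ) < 1 := by linarith
    exact_mod_cast this
  have hj2 : -2 < j := by
    have : (-2 : ℝ) < j := by linarith
    exact_mod_cast this
  obtain rfl | rfl : j = 0 ∨ j = -1 := by omega
  · refine notMem_symmSCantorSet_sub_self hl hp hlp ?_ ?_ hy <;> push_cast <;> linarith
  · rw [mem_sDigits_sub_sDigits_iff hl hlp, show d = 2 * l + p * k by linarith] at hd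
    have hk1 : k < 1 := by
      by_contra! hcon
      have : (p : ℤ) ≤ p * k := le_mul_of_one_le_right (by omega) hcon
      rw [abs_of_nonneg (by omega)] at hd
      omega
    have hk2 : -2 < k := by
      by_contra! hcon
      have : (p : ℤ) * k ≤ p * (-2) := by gcongr
      rw [abs_of_nonpos (by omega)] at hd
      omega
    obtain rfl | rfl : k = 0 ∨ k = -1 := by omega
    · rw [abs_of_nonneg (by omega)] at hd
      omega
    · rw [abs_of_nonpos (by omega)] at hd
      omega

lemma interior_symmSCantorSet_sub_self_nonempty (hl : 1 ≤ l) (hp : 2 < p) (hlp : 2 * l < p)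
    (h4 : p < 4 * l) : (interior (symmSCantorSet l p - symmSCantorSet l p)).Nonempty := by
  refine (isCenteredAttractor_symmSCantorSet hl hp hlp).interior_nonempty fun k => ?_
  have hk1 := Int.emod_nonneg k (by omega : (p : ℤ) ≠ 0)
  have hk2 := Int.emod_lt_of_pos k (by omega : (0 : ℤ) < p)
  have hk3 := Int.emod_add_mul_ediv k p
  simp only [mem_sDigits_sub_sDigits_iff hl hlp]
  -- The residues l, …, p - 2l not represented in [0, p - 1] are reached by negative digits: r - p ∈
  -- B as soon as r ≤ 2l - 1, and p - 2l ≤ 2l - 1.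
  by_cases h1 : k % p ≤ l - 1 ∨ (p : ℤ) - 2 * l + 1 ≤ k % p
  · refine ⟨k % p, ?_, k / p, hk3.symm⟩
    rw [abs_of_nonneg hk1]
    omega
  · refine ⟨k % p - p, ?_, k / p + 1, by linarith⟩
    rw [abs_of_nonpos (by omega)]
    omega

end SymmSCantorSet

theorem corollary9 (l p : ℕ) (hl : 1 ≤ l) (hp : 2 < p) (hlp : 2 * l < p) :
    (symmSCantorSet l p - symmSCantorSet l p = Set.Icc (-1 : ℝ) 1 ↔
      (1 / 3 : ℝ) ≤ (l : ℝ) / (p : ℝ)) ∧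
    (IsCantorSet (symmSCantorSet l p - symmSCantorSet l p) ↔
      (l : ℝ) / (p : ℝ) ≤ (1 / 4 : ℝ)) ∧
    (IsMCantorval (symmSCantorSet l p - symmSCantorSet l p) ↔
      (l : ℝ) / (p : ℝ) ∈ Set.Ioo (1 / 4 : ℝ) (1 / 3 : ℝ)) := by
  have hp0 : (0 : ℝ) < p := by positivity
  have e3 : (1 / 3 : ℝ) ≤ (l : ℝ) / (p : ℝ) ↔ p ≤ 3 * l := by
    rw [div_le_div_iff₀ (by norm_num) hp0, one_mul, mul_comm (l : ℝ)]
    exact_mod_cast Iff.rfl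
  have e4 : (l : ℝ) / (p : ℝ) ≤ (1 / 4 : ℝ) ↔ 4 * l ≤ p := by
    rw [div_le_div_iff₀ hp0 (by norm_num), one_mul, mul_comm (l : ℝ)]
    exact_mod_cast Iff.rfl
  have h := isCenteredAttractor_symmSCantorSet hl hp hlp
  have hne := interior_symmSCantorSet_sub_self_nonempty hl hp hlp
  rw [Set.mem_Ioo, ← not_le, ← not_le, e3, e4]
  refine ⟨⟨fun heq => ?_, symmSCantorSet_sub_self_eq_Icc hl hp hlp⟩, ⟨fun hC => ?_, fun h4 =>
    h.isCantorSet (interior_symmSCantorSet_sub_self_eq_empty hl hp hlp h4)⟩,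
    fun hM => ⟨fun h4 => ?_, fun h3 => ?_⟩, fun ⟨h4, h3⟩ => ?_⟩
  · by_contra! h3
    obtain ⟨c, hc, hcD⟩ := exists_notMem_symmSCantorSet_sub_self hl hp hlp h3
    rw [heq] at hcD
    exact hcD ⟨by linarith [hc.1], hc.2.le⟩
  · by_contra! h4
    exact (hne h4).ne_empty (h.isClosed.isNowhereDense_iff.1 hC.nowhereDense)
  · exact hM.interior_nonempty.ne_empty (interior_symmSCantorSet_sub_self_eq_empty hl hp hlp h4)
  · obtain ⟨G, hG⟩ := hM.exists_isGap
    rw [symmSCantorSet_sub_self_eq_Icc hl hp hlp h3] at hG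
    exact not_isGap_Icc G hG
  · obtain ⟨c, hc, hcD⟩ := exists_notMem_symmSCantorSet_sub_self hl hp hlp (not_le.1 h3)
    exact h.isMCantorval (hne (not_le.1 h4)) hc hcD
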